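/- Fix $d\ge 1$. An action set consists of finitely many actions $a_i=(x_i,z_i)\in\mathbb R^{d}\times\{-1,1\}\subset\mathbb R^{d+1}$, $i=1,\dots,k$, whose covariates $x_1,\dots,x_k$ are distinct, in which both groups $\{i: z_i=1\}$ and $\{i: z_i=-1\}$ are non-empty, and whose vectors $a_i$ span $\mathbb R^{d+1}$. For a probability vector $\pi=(\pi_1,\dots,\pi_k)$ let $V(\pi)=\sum_i \pi_i a_i a_i^\top$, and let $V(\pi)^+$ be a generalized inverse of $V(\pi)$. For $\kappa_*\ge 1$ the action set is called $\kappa_*$-correlated if $$\min_{\pi:\ e_{d+1}\in \mathrm{Im}\,V(\pi)} e_{d+1}^\top V(\pi)^+e_{d+1}\ \ge\ \kappa_*,$$ where $e_{d+1}$ is the last vector of the canonical basis of $\mathbb R^{d+1}$. In the biased linear bandit problem with parameter $\theta=(\gamma,\omega)\in\mathbb R^d\times\mathbb R$, where $\max_i|x_i^\top\gamma|\le 1$, an algorithm chooses at each round $t=1,\dots,T$ an action $i_t$, on the basis of the past actions and evaluations and possibly of additional randomization, and then observes the evaluation $y_t=x_{i_t}^\top\gamma+z_{i_t}\omega+\xi_t$,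 where the noise variables $\xi_t$ are i.i.d. $\mathcal N(0,1)$. Its regret is $$R_T^{\theta}=\mathbb E\Big[\sum_{t\le T}\big(\max_i x_i^\top\gamma-x_{i_t}^\top\gamma\big)\Big].$$ Theorem. Let $\kappa_*\ge 1$, let $d\ge 2$ be an integer, and let $T\ge 4^3\kappa_*$ be an integer. There exists a $\kappa_*$-correlated action set in $\mathbb R^{d+1}$ such that for every algorithm there exists a parameter $\theta_T=(\gamma_T,\omega_T)\in\mathbb R^{d+1}$ with $\max_i|x_i^\top\gamma_T|\le 1$ such that the regret of this algorithm on the problem with parameter $\theta_T$ satisfies $$R_T^{\theta_T}\ \ge\ \frac{\kappa_*^{1/3}\,T^{2/3}}{8e}.$$ -/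

import Mathlib

open MeasureTheory ProbabilityTheory Matrix

/-- An action set of the biased linear bandit in dimension `d`: finitely many actions, the `i`-th one
being described by a covariate `x i ∈ ℝᵈ` and by a sensitive attribute `z i ∈ {-1, 1}`. The covariates
are distinct, no group is empty, and the vectors `(x i, z i)` span `ℝᵈ⁺¹`. -/
structure ActionSet (d : ℕ) where
  /-- number of actions -/
  k : ℕ
  /-- covariates -/
  x : Fin k → Fin d → ℝ
  /-- sensitive attributes -/
  z : Fin k → ℤˣ
  x_injective : Function.Injective x
  exists_group_pos : ∃ i, z i = 1
  exists_group_neg : ∃ i, z i = -1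
  span_eq_top :
    Submodule.span ℝ (Set.range fun i =>
      (Fin.snoc (x i) ((z i : ℤ) : ℝ) : Fin (d + 1) → ℝ)) = ⊤

namespace ActionSet

variable {d : ℕ}

/-- The vector `a_x = (x, z_x) ∈ ℝᵈ⁺¹` describing an action and its group. -/
def a (A : ActionSet d) (i : Fin A.k) : Fin (d + 1) → ℝ :=
  Fin.snoc (A.x i) ((A.z i : ℤ) : ℝ)

/-- The covariance matrix `V(π) = ∑ π(a) a aᵀ` of an allocation `π`. -/
def V (A : ActionSet d) (π : Fin A.k → ℝ) : Matrix (Fin (d + 1)) (Fin (d + 1)) ℝ :=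
  ∑ i, π i • vecMulVec (A.a i) (A.a i)

/-- The last vector `e_{d+1}` of the canonical basis of `ℝᵈ⁺¹`. -/
def eLast (d : ℕ) : Fin (d + 1) → ℝ := Pi.single (Fin.last d) 1

/-- The probability measures `π` on the action set such that `e_{d+1}` is in the image of `V(π)`. -/
def biasDesigns (A : ActionSet d) : Set (Fin A.k → ℝ) :=
  {π | π ∈ stdSimplex ℝ (Fin A.k) ∧ ∃ w, A.V π *ᵥ w = eLast d}

end ActionSet

/-- `G` is a generalized inverse of `M`. -/
def IsGeneralizedInverse {n : ℕ} (M G : Matrix (Fin n) (Fin n) ℝ) : Prop :=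
  M * G * M = M

/-- For a symmetric `M` and `u` in its image, `uᵀ M⁺ u` does not depend on the choice of the generalized
inverse `M⁺`. -/
theorem IsGeneralizedInverse.quadForm_eq {n : ℕ} {M G G' : Matrix (Fin n) (Fin n) ℝ}
    (hM : Mᵀ = M) (hG : IsGeneralizedInverse M G) (hG' : IsGeneralizedInverse M G')
    {u : Fin n → ℝ} (hu : ∃ w, M *ᵥ w = u) : u ⬝ᵥ G *ᵥ u = u ⬝ᵥ G' *ᵥ u := by
  obtain ⟨w, rfl⟩ := hu
  have key : ∀ H, IsGeneralizedInverse M H → (M *ᵥ w) ⬝ᵥ H *ᵥ (M *ᵥ w) = w ⬝ᵥ M *ᵥ w := by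
    intro H hH
    have h1 : M *ᵥ w = w ᵥ* M := by rw [← vecMul_transpose, hM]
    conv_lhs => rw [h1, ← dotProduct_mulVec, ← h1, mulVec_mulVec, mulVec_mulVec, hH]
  rw [key G hG, key G' hG']

namespace ActionSet

variable {d : ℕ}

/-- The variances `e_{d+1}ᵀ V(π)⁺ e_{d+1}` of the bias estimator, for `π` ranging over the designs for
which the bias is estimable. -/
def biasVariances (A : ActionSet d) : Set ℝ :=
  {v | ∃ π ∈ A.biasDesigns, ∃ G, IsGeneralizedInverse (A.V π) G ∧ v = eLast d ⬝ᵥ G *ᵥ eLast d}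

/-- The action set is `κ`-correlated: the minimal variance of the bias estimator is at least `κ`. -/
def IsCorrelated (A : ActionSet d) (κ : ℝ) : Prop :=
  ∃ m, IsLeast A.biasVariances m ∧ κ ≤ m

/-- The gap `max_{x'} (x' - x)ᵀ γ` of an action `x`, where `γ ∈ ℝᵈ` consists of the first `d` coordinates
of the parameter `θ = (γ, ω) ∈ ℝᵈ⁺¹`. -/
noncomputable def gap (A : ActionSet d) (θ : Fin (d + 1) → ℝ) (i : Fin A.k) : ℝ :=
  ⨆ j, (A.x j - A.x i) ⬝ᵥ (Fin.init θ : Fin d → ℝ)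

/-- The parameter `θ = (γ, ω)` is admissible: all rewards `xᵀ γ` are bounded by `1` in absolute value. -/
def Admissible (A : ActionSet d) (θ : Fin (d + 1) → ℝ) : Prop :=
  ∀ i, |A.x i ⬝ᵥ (Fin.init θ : Fin d → ℝ)| ≤ 1

/-- The law of the evaluation `xᵀ γ + z_x ω + ξ`, with `ξ ∼ 𝒩(0, 1)`, given the chosen action. -/
noncomputable def evaluation (A : ActionSet d) (θ : Fin (d + 1) → ℝ) : Kernel (Fin A.k) ℝ where
  toFun i := gaussianReal (A.x i ⬝ᵥ (Fin.init θ : Fin d → ℝ) + ((A.z i : ℤ) : ℝ) * θ (Fin.last d)) 1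
  measurable' := measurable_of_countable _

instance (A : ActionSet d) (θ : Fin (d + 1) → ℝ) : IsMarkovKernel (A.evaluation θ) :=
  ⟨fun _ => inferInstanceAs (IsProbabilityMeasure (gaussianReal _ _))⟩

end ActionSet

/-- A (possibly randomized) bandit algorithm with `k` actions: given the actions and the evaluations
of the first `t` rounds, it draws the next action from a law that depends measurably on them. -/
structure BanditAlgorithm (k : ℕ) where
  policy : (t : ℕ) → Kernel (Fin t → Fin k × ℝ) (Fin k)
  isMarkov : ∀ t, IsMarkovKernel (policy t)

namespace BanditAlgorithm

instance {k : ℕ} (alg : BanditAlgorithm k) (t : ℕ) : IsMarkovKernel (alg.policy t) :=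
  alg.isMarkov t

variable {d : ℕ} {A : ActionSet d}

/-- The law of the actions and evaluations of the first `t` rounds, when the algorithm is run on the
biased linear bandit problem with parameter `θ`: at each round an action is drawn from the policy
given the past, and then an evaluation is drawn that depends on the past only through this action. -/
noncomputable def historyLaw (alg : BanditAlgorithm A.k) (θ : Fin (d + 1) → ℝ) :
    (t : ℕ) → Measure (Fin t → Fin A.k × ℝ)
  | 0 => Measure.dirac Fin.elim0
  | t + 1 =>
    (alg.historyLaw θ t ⊗ₘ (alg.policy t ⊗ₖ (A.evaluation θ).prodMkLeft (Fin t → Fin A.k × ℝ))).map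
      fun p => Fin.snoc p.1 p.2

/-- The map that appends a round to a history is measurable. -/
theorem measurable_snoc (k t : ℕ) :
    Measurable fun p : (Fin t → Fin k × ℝ) × (Fin k × ℝ) =>
      (Fin.snoc p.1 p.2 : Fin (t + 1) → Fin k × ℝ) := by
  refine measurable_pi_lambda _ fun i => ?_
  induction i using Fin.lastCases with
  | last => simpa using measurable_snd
  | cast i => simpa using! (measurable_pi_apply i).comp measurable_fst

instance isProbabilityMeasure_historyLaw (alg : BanditAlgorithm A.k) (θ : Fin (d + 1) → ℝ) (t : ℕ) :
    IsProbabilityMeasure (alg.historyLaw θ t) := by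
  induction t with
  | zero => unfold historyLaw; infer_instance
  | succ t ih =>
    unfold historyLaw
    exact Measure.isProbabilityMeasure_map (measurable_snoc A.k t).aemeasurable

/-- The regret `R_T = 𝔼[∑_{t ≤ T} (x* - x_t)ᵀ γ]` of the algorithm on the problem with parameter `θ`. -/
noncomputable def regret (alg : BanditAlgorithm A.k) (θ : Fin (d + 1) → ℝ) (T : ℕ) : ℝ :=
  ∫ h, ∑ t, A.gap θ (h t).1 ∂(alg.historyLaw θ T)

end BanditAlgorithm

/-! Estimating the bias is expensive when the only actions that reveal it have bad rewards. In the
hard set, with `ρ = κ^(-1/2)`, the first two covariates are basis vectors `e₁`, `e₂` in opposite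
groups, and all other actions have the same first two coordinates `(-ρ, ρ - 1)`. The parameters used
vanish on the remaining coordinates, so these other actions behave as a single one.

Two parameters swap the rewards `1` and `1 - Δ` of the first two actions, with biases `∓Δ/2` that
hide the swap: the evaluations of both actions have mean `1 - Δ/2` under either parameter. The means
of the other actions move by only `2ρΔ`, while each costs at least `1`. If `N` is the expected
number of costly plays under the first parameter, the divergence between the two histories is
`2ρ²Δ²N`, and small regret makes `N` small. The Bretagnolle–Huber inequality
(`exp_integral_le_measureReal_compl_add`) then prevents the algorithm from telling the parameters
apart, and the wrong preference costs `Δ` on half of the rounds. Balancing gives `Δ = (κ/T)^(1/3)`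
and a regret of order `ΔT`.

Two ingredients carry this: the divergence decomposition for adaptive play
(`integral_sum_logLikelihoodRatio`), and Elfving's criterion (`isLeast_biasVariances`), which
identifies the minimal bias variance as exactly `ρ⁻²`. -/

/-! ### Gaussian tilts and the Bretagnolle–Huber inequality. -/

/-- A real Gaussian law of variance one is obtained from another one by an exponential tilt. -/
theorem gaussianReal_one_eq_withDensity (m m' : ℝ) :
    gaussianReal m' 1 = (gaussianReal m 1).withDensity
      fun y => ENNReal.ofReal (Real.exp ((y - m) * (m' - m) - (m' - m) ^ 2 / 2)) := by
  rw [gaussianReal_of_var_ne_zero _ one_ne_zero, gaussianReal_of_var_ne_zero _ one_ne_zero,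
    ← withDensity_mul _ (measurable_gaussianPDF _ _) (by fun_prop)]
  congr 1
  funext y
  simp only [gaussianPDF, Pi.mul_apply, gaussianPDFReal]
  rw [← ENNReal.ofReal_mul (by positivity), mul_assoc (Inv.inv _), ← Real.exp_add]
  congr 4
  simp
  ring

/-- **Bretagnolle–Huber inequality**, for a law `Q` of density `exp ℓ` with respect to `P`. -/
theorem exp_integral_le_measureReal_compl_add {Ω : Type*} [MeasurableSpace Ω] {P Q : Measure Ω}
    [IsProbabilityMeasure P] [IsProbabilityMeasure Q] {ℓ : Ω → ℝ} (hm : Measurable ℓ)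
    (hℓ : Integrable ℓ P) (hQ : Q = P.withDensity fun ω => ENNReal.ofReal (Real.exp (ℓ ω)))
    {B : Set Ω} (hB : MeasurableSet B) :
    Real.exp (∫ ω, ℓ ω ∂P) / 2 ≤ P.real Bᶜ + Q.real B := by
  have hL : Integrable (fun ω => Real.exp (ℓ ω)) P := by
    refine ⟨by fun_prop, ?_⟩
    rw [hasFiniteIntegral_iff_ofReal (ae_of_all _ fun _ => (Real.exp_pos _).le)]
    have h1 : Q Set.univ = ∫⁻ ω, ENNReal.ofReal (Real.exp (ℓ ω)) ∂P := by
      rw [hQ, withDensity_apply _ MeasurableSet.univ, Measure.restrict_univ]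
    rw [← h1]
    exact measure_lt_top _ _
  have hQB : ∀ C : Set Ω, MeasurableSet C → ∫ ω in C, Real.exp (ℓ ω) ∂P = Q.real C := by
    intro C hC
    rw [integral_eq_lintegral_of_nonneg_ae (ae_of_all _ fun _ => (Real.exp_pos _).le)
      (by fun_prop), Measure.real, hQ, withDensity_apply _ hC]
  have hL1 : ∫ ω, Real.exp (ℓ ω) ∂P = 1 := by
    have := hQB Set.univ MeasurableSet.univ
    simpa using this
  -- Jensen and Cauchy–Schwarz are merged into one pointwise inequality: the tangent line of `exp`
  -- at `m` bounds `exp (ℓ/2)` from below, and AM-GM, with weights tuned to `exp m`, bounds it from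
  -- above, differently on `B` and off `B`. After integration the `m` terms cancel on the left,
  -- leaving `2 * exp m`.
  set m : ℝ := (∫ ω, ℓ ω ∂P) / 2 with hmdef
  have hpt : ∀ ω, 2 * Real.exp m * (1 - m) + Real.exp m * ℓ ω ≤
      2 * (Real.exp m)⁻¹ * (Bᶜ.indicator (fun _ => (1 : ℝ)) ω
        + B.indicator (fun ω => Real.exp (ℓ ω)) ω)
      + Real.exp m / 2 * (1 + Real.exp (ℓ ω)) := by
    intro ω
    have hE := Real.exp_pos m
    have hs : Real.exp (ℓ ω) = Real.exp (ℓ ω / 2) ^ 2 := by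
      rw [← Real.exp_nat_mul]; congr 1; push_cast; ring
    have h1 : Real.exp m * (1 + (ℓ ω / 2 - m)) ≤ Real.exp (ℓ ω / 2) := by
      have : Real.exp (ℓ ω / 2) = Real.exp m * Real.exp (ℓ ω / 2 - m) := by
        rw [← Real.exp_add]; congr 1; ring
      rw [this]
      gcongr
      linarith [Real.add_one_le_exp (ℓ ω / 2 - m)]
    rw [hs]
    set s := Real.exp (ℓ ω / 2)
    set E := Real.exp m
    have hE' : E * E⁻¹ = 1 := mul_inv_cancel₀ hE.ne'
    have hEi : 0 < E⁻¹ := inv_pos.mpr hE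
    by_cases hω : ω ∈ B
    · have h2 : 2 * s ≤ 2 * E⁻¹ * s ^ 2 + E / 2 := by
        have : 2 * E⁻¹ * s ^ 2 + E / 2 - 2 * s = 2 * E⁻¹ * (s - E / 2) ^ 2 := by
          field_simp; ring
        nlinarith [mul_nonneg hEi.le (sq_nonneg (s - E / 2))]
      simp only [Set.mem_compl_iff, hω, not_true, not_false_eq_true, Set.indicator_of_notMem,
        Set.indicator_of_mem]
      nlinarith [mul_nonneg hE.le (sq_nonneg s)]
    · have h2 : 2 * s ≤ 2 * E⁻¹ + E / 2 * s ^ 2 := by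
        have : 2 * E⁻¹ + E / 2 * s ^ 2 - 2 * s = 2 * E⁻¹ * (1 - E / 2 * s) ^ 2 := by
          field_simp; ring
        nlinarith [mul_nonneg hEi.le (sq_nonneg (1 - E / 2 * s))]
      simp only [Set.mem_compl_iff, hω, not_false_eq_true, Set.indicator_of_notMem,
        Set.indicator_of_mem]
      nlinarith
  have i1 : Integrable (Bᶜ.indicator fun _ => (1 : ℝ)) P :=
    (integrable_const _).indicator hB.compl
  have i2 : Integrable (B.indicator fun ω => Real.exp (ℓ ω)) P := hL.indicator hB
  have i3 : Integrable (fun ω => Bᶜ.indicator (fun _ => (1 : ℝ)) ω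
      + B.indicator (fun ω => Real.exp (ℓ ω)) ω) P := i1.add i2
  have i4 : Integrable (fun ω => 1 + Real.exp (ℓ ω)) P := (integrable_const 1).add hL
  have hint := integral_mono ((integrable_const _).add (hℓ.const_mul _))
    ((i3.const_mul _).add (i4.const_mul _)) hpt
  simp only [Pi.add_apply] at hint
  rw [integral_add (integrable_const _) (hℓ.const_mul _),
    integral_add (i3.const_mul _) (i4.const_mul _),
    integral_const, integral_const_mul, integral_const_mul, integral_const_mul, integral_add (by exact i1) i2,
    integral_add (integrable_const 1) hL, integral_indicator hB, integral_indicator hB.compl,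
    hQB B hB, hL1] at hint
  simp only [integral_const, smul_eq_mul, probReal_univ, mul_one, one_mul,
    measureReal_restrict_apply_univ] at hint
  have h2m : ∫ ω, ℓ ω ∂P = 2 * m := by rw [hmdef]; ring
  rw [h2m] at hint ⊢
  have hE := Real.exp_pos m
  have hE2 : Real.exp (2 * m) = Real.exp m ^ 2 := by
    rw [← Real.exp_nat_mul]; norm_num
  rw [hE2]
  set E := Real.exp m
  set X := P.real Bᶜ + Q.real B
  have h3 : E ≤ 2 * E⁻¹ * X := by linarith
  have h4 : E * E ≤ E * (2 * E⁻¹ * X) := by gcongr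
  have h5 : E * (2 * E⁻¹ * X) = 2 * X := by field_simp
  nlinarith

/-! ### Likelihood ratio of a single round. -/

namespace ActionSet

variable {d : ℕ}

/-- The mean of the evaluation of an action. -/
def meanEvaluation (A : ActionSet d) (θ : Fin (d + 1) → ℝ) (i : Fin A.k) : ℝ :=
  A.x i ⬝ᵥ (Fin.init θ : Fin d → ℝ) + ((A.z i : ℤ) : ℝ) * θ (Fin.last d)

theorem evaluation_apply (A : ActionSet d) (θ : Fin (d + 1) → ℝ) (i : Fin A.k) :
    A.evaluation θ i = gaussianReal (A.meanEvaluation θ i) 1 := rfl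

/-- The log-likelihood ratio of an action and its evaluation, for `θ'` against `θ`. -/
noncomputable def logLikelihoodRatio (A : ActionSet d) (θ θ' : Fin (d + 1) → ℝ)
    (p : Fin A.k × ℝ) : ℝ :=
  (p.2 - A.meanEvaluation θ p.1) * (A.meanEvaluation θ' p.1 - A.meanEvaluation θ p.1)
    - (A.meanEvaluation θ' p.1 - A.meanEvaluation θ p.1) ^ 2 / 2

theorem measurable_logLikelihoodRatio (A : ActionSet d) (θ θ' : Fin (d + 1) → ℝ) :
    Measurable (A.logLikelihoodRatio θ θ') := by
  have h : ∀ f : Fin A.k → ℝ, Measurable fun p : Fin A.k × ℝ => f p.1 := fun f =>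
    (measurable_of_countable f).comp measurable_fst
  have h1 := h (A.meanEvaluation θ)
  have h2 := h (A.meanEvaluation θ')
  unfold logLikelihoodRatio
  fun_prop

theorem evaluation_eq_withDensity (A : ActionSet d) (θ θ' : Fin (d + 1) → ℝ) (i : Fin A.k) :
    A.evaluation θ' i = (A.evaluation θ i).withDensity
      fun y => ENNReal.ofReal (Real.exp (A.logLikelihoodRatio θ θ' (i, y))) :=
  gaussianReal_one_eq_withDensity _ _

theorem integrable_id_evaluation (A : ActionSet d) (θ : Fin (d + 1) → ℝ) (i : Fin A.k) :
    Integrable (fun y => y) (A.evaluation θ i) := by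
  rw [evaluation_apply]
  exact (memLp_id_gaussianReal 1).integrable le_rfl

theorem integral_id_evaluation (A : ActionSet d) (θ : Fin (d + 1) → ℝ) (i : Fin A.k) :
    ∫ y, y ∂(A.evaluation θ i) = A.meanEvaluation θ i := by
  rw [evaluation_apply]
  exact integral_id_gaussianReal

end ActionSet

/-! ### Laws of histories and change of measure. -/

namespace BanditAlgorithm

variable {d : ℕ} {A : ActionSet d}

/-- Integration over the law of the first `t + 1` rounds, one round at a time. -/
theorem lintegral_historyLaw_succ (alg : BanditAlgorithm A.k) (θ : Fin (d + 1) → ℝ) (t : ℕ)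
    {f : (Fin (t + 1) → Fin A.k × ℝ) → ENNReal} (hf : Measurable f) :
    ∫⁻ h, f h ∂(alg.historyLaw θ (t + 1)) =
      ∫⁻ h, ∫⁻ i, ∫⁻ y, f (Fin.snoc h (i, y)) ∂(A.evaluation θ i) ∂(alg.policy t h)
        ∂(alg.historyLaw θ t) := by
  have hs := measurable_snoc A.k t
  rw [historyLaw, lintegral_map hf hs,
    Measure.lintegral_compProd (f := fun p => f (Fin.snoc p.1 p.2)) (hf.comp hs)]
  refine lintegral_congr fun h => ?_
  rw [Kernel.lintegral_compProd _ _ _ (f := fun p => f (Fin.snoc h p)) ((hf.comp hs).comp measurable_prodMk_left)]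
  rfl

/-- The law of the history under `θ'` has an explicit density with respect to the one under `θ`. -/
theorem lintegral_historyLaw_eq (alg : BanditAlgorithm A.k) (θ θ' : Fin (d + 1) → ℝ) (t : ℕ)
    {f : (Fin t → Fin A.k × ℝ) → ENNReal} (hf : Measurable f) :
    ∫⁻ h, f h ∂(alg.historyLaw θ' t) =
      ∫⁻ h, ENNReal.ofReal (Real.exp (∑ s, A.logLikelihoodRatio θ θ' (h s))) * f h
        ∂(alg.historyLaw θ t) := by
  induction t with
  | zero => simp [historyLaw]
  | succ t ih =>
    have hℓ := A.measurable_logLikelihoodRatio θ θ'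
    have hs := measurable_snoc A.k t
    have hg : Measurable fun p : ((Fin t → Fin A.k × ℝ) × Fin A.k) × ℝ =>
        ENNReal.ofReal (Real.exp (A.logLikelihoodRatio θ θ' (p.1.2, p.2))) *
          f (Fin.snoc p.1.1 (p.1.2, p.2)) := by
      refine Measurable.mul ?_ ?_
      · exact ((hℓ.comp (by fun_prop : Measurable fun p : ((Fin t → Fin A.k × ℝ) × Fin A.k) × ℝ =>
          (p.1.2, p.2))).exp).ennreal_ofReal
      · exact hf.comp (hs.comp (by fun_prop :
          Measurable fun p : ((Fin t → Fin A.k × ℝ) × Fin A.k) × ℝ => (p.1.1, (p.1.2, p.2))))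
    rw [lintegral_historyLaw_succ _ _ _ hf, lintegral_historyLaw_succ _ _ _ (by fun_prop)]
    -- The policy is the same under both parameters, so only the law of the evaluation contributes a
    -- density.
    have h1 : ∀ h : Fin t → Fin A.k × ℝ, ∀ i, ∫⁻ y, f (Fin.snoc h (i, y)) ∂(A.evaluation θ' i) =
        ∫⁻ y, ENNReal.ofReal (Real.exp (A.logLikelihoodRatio θ θ' (i, y))) *
          f (Fin.snoc h (i, y)) ∂(A.evaluation θ i) := by
      intro h i
      rw [A.evaluation_eq_withDensity θ θ' i, lintegral_withDensity_eq_lintegral_mul]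
      · rfl
      · exact ((hℓ.comp measurable_prodMk_left).exp).ennreal_ofReal
      · exact hf.comp (hs.comp (measurable_prodMk_left.comp measurable_prodMk_left))
    simp_rw [h1]
    have hk : Measurable fun p : (Fin t → Fin A.k × ℝ) × Fin A.k =>
        ∫⁻ y, ENNReal.ofReal (Real.exp (A.logLikelihoodRatio θ θ' (p.2, y))) *
          f (Fin.snoc p.1 (p.2, y)) ∂(A.evaluation θ p.2) :=
      Measurable.lintegral_kernel_prod_right (κ := (A.evaluation θ).prodMkLeft _) hg
    -- The induction hypothesis holds for every measurable function of the past; here it is applied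
    -- to the integral over the last round.
    rw [ih (Measurable.lintegral_kernel_prod_right (κ := alg.policy t)
      (f := fun h i => ∫⁻ y, ENNReal.ofReal (Real.exp (A.logLikelihoodRatio θ θ' (i, y))) *
        f (Fin.snoc h (i, y)) ∂(A.evaluation θ i)) hk)]
    refine lintegral_congr fun h => ?_
    rw [← lintegral_const_mul _ (by fun_prop)]
    refine lintegral_congr fun i => ?_
    have hy : Measurable fun y => ENNReal.ofReal (Real.exp (A.logLikelihoodRatio θ θ' (i, y))) *
        f (Fin.snoc h (i, y)) := hg.comp (f := fun y => ((h, i), y)) (by fun_prop)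
    rw [← lintegral_const_mul _ hy]
    refine lintegral_congr fun y => ?_
    rw [← mul_assoc, Fin.sum_univ_castSucc, Real.exp_add, ENNReal.ofReal_mul (Real.exp_nonneg _)]
    simp

theorem historyLaw_eq_withDensity (alg : BanditAlgorithm A.k) (θ θ' : Fin (d + 1) → ℝ) (t : ℕ) :
    alg.historyLaw θ' t = (alg.historyLaw θ t).withDensity
      fun h => ENNReal.ofReal (Real.exp (∑ s, A.logLikelihoodRatio θ θ' (h s))) := by
  have hℓ := A.measurable_logLikelihoodRatio θ θ'
  refine Measure.ext_of_lintegral _ fun f hf => ?_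
  rw [alg.lintegral_historyLaw_eq θ θ' t hf, lintegral_withDensity_eq_lintegral_mul _
    (by fun_prop) hf]
  rfl

/-- A function of the action and the evaluation of a round that is conditionally centred given the
action has a centred sum over the rounds. -/
theorem integral_sum_eq_zero_of_centered (alg : BanditAlgorithm A.k) (θ : Fin (d + 1) → ℝ) (t : ℕ)
    {f : Fin A.k × ℝ → ℝ} (hf : Measurable f)
    (hint : ∀ i, Integrable (fun y => f (i, y)) (A.evaluation θ i))
    (hzero : ∀ i, ∫ y, f (i, y) ∂(A.evaluation θ i) = 0) :
    Integrable (fun h => ∑ s, f (h s)) (alg.historyLaw θ t) ∧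
      ∫ h, ∑ s, f (h s) ∂(alg.historyLaw θ t) = 0 := by
  induction t with
  | zero => simp
  | succ t ih =>
    have hs := measurable_snoc A.k t
    have hround : ∀ ν : Measure (Fin A.k), IsProbabilityMeasure ν →
        Integrable f (ν ⊗ₘ A.evaluation θ) := by
      intro ν _
      rw [Measure.integrable_compProd_iff hf.aestronglyMeasurable]
      exact ⟨ae_of_all _ hint, Integrable.of_finite⟩
    have hker : ∀ h, (alg.policy t ⊗ₖ (A.evaluation θ).prodMkLeft (Fin t → Fin A.k × ℝ)) h =
        alg.policy t h ⊗ₘ A.evaluation θ := by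
      intro h
      rw [Kernel.compProd_apply_eq_compProd_sectR]
      rfl
    have hround0 : ∀ h, ∫ p, f p
        ∂((alg.policy t ⊗ₖ (A.evaluation θ).prodMkLeft (Fin t → Fin A.k × ℝ)) h) = 0 := by
      intro h
      rw [hker, Measure.integral_compProd (hround _ inferInstance)]
      simp [hzero]
    have i1 : Integrable (fun p : (Fin t → Fin A.k × ℝ) × (Fin A.k × ℝ) => ∑ s, f (p.1 s))
        (alg.historyLaw θ t ⊗ₘ
          (alg.policy t ⊗ₖ (A.evaluation θ).prodMkLeft (Fin t → Fin A.k × ℝ))) := by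
      refine Integrable.comp_measurable (f := Prod.fst) (g := fun h : Fin t → Fin A.k × ℝ => ∑ s, f (h s)) ?_ measurable_fst
      rw [← Measure.fst, Measure.fst_compProd]
      exact ih.1
    have i2 : Integrable (fun p : (Fin t → Fin A.k × ℝ) × (Fin A.k × ℝ) => f p.2)
        (alg.historyLaw θ t ⊗ₘ
          (alg.policy t ⊗ₖ (A.evaluation θ).prodMkLeft (Fin t → Fin A.k × ℝ))) := by
      rw [Measure.integrable_compProd_iff
        (show Measurable fun p : (Fin t → Fin A.k × ℝ) × (Fin A.k × ℝ) => f p.2 from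
          hf.comp measurable_snd).aestronglyMeasurable]
      refine ⟨ae_of_all _ fun h => ?_, ?_⟩
      · rw [hker]
        exact hround _ inferInstance
      -- There are finitely many actions, so the sum of their absolute moments bounds the
      -- conditional one uniformly in the past, whatever the policy.
      · refine Integrable.of_bound (C := ∑ i, ∫ y, ‖f (i, y)‖ ∂(A.evaluation θ i))
          (StronglyMeasurable.integral_kernel_prod_right
            (f := fun _ p => ‖f p‖) (by fun_prop)).aestronglyMeasurable
          (ae_of_all _ fun h => ?_)
        have hnn : ∀ i, 0 ≤ ∫ y, ‖f (i, y)‖ ∂(A.evaluation θ i) := fun i =>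
          integral_nonneg fun _ => norm_nonneg _
        rw [Real.norm_of_nonneg (integral_nonneg fun _ => norm_nonneg _), hker,
          Measure.integral_compProd (hround _ inferInstance).norm]
        calc _ ≤ ∫ _, ∑ i, ∫ y, ‖f (i, y)‖ ∂(A.evaluation θ i) ∂(alg.policy t h) :=
              integral_mono Integrable.of_finite (integrable_const _) fun i =>
                Finset.single_le_sum (f := fun i => ∫ y, ‖f (i, y)‖ ∂(A.evaluation θ i))
                  (fun i _ => hnn i) (Finset.mem_univ i)
          _ = _ := by simp
    have hsum : ∀ p : (Fin t → Fin A.k × ℝ) × (Fin A.k × ℝ),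
        ∑ s, f ((Fin.snoc p.1 p.2 : Fin (t + 1) → Fin A.k × ℝ) s) = ∑ s, f (p.1 s) + f p.2 := by
      intro p
      simp [Fin.sum_univ_castSucc]
    have hF : Measurable fun h : Fin (t + 1) → Fin A.k × ℝ => ∑ s, f (h s) := by fun_prop
    rw [historyLaw]
    constructor
    · rw [integrable_map_measure hF.aestronglyMeasurable hs.aemeasurable]
      exact (i1.add i2).congr (ae_of_all _ fun p => (hsum p).symm)
    · rw [integral_map hs.aemeasurable hF.aestronglyMeasurable, integral_congr_ae
        (ae_of_all _ hsum), integral_add i1 i2, Measure.integral_compProd i1,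
        Measure.integral_compProd i2]
      simp [hround0, ih.2]

/-- Functions of the actions of a history are integrable. -/
theorem integrable_sum_action (alg : BanditAlgorithm A.k) (θ : Fin (d + 1) → ℝ) (t : ℕ)
    (g : Fin A.k → ℝ) : Integrable (fun h => ∑ s, g (h s).1) (alg.historyLaw θ t) := by
  refine integrable_finsetSum _ fun s _ => ?_
  exact Integrable.comp_measurable (f := fun h : Fin t → Fin A.k × ℝ => (h s).1)
    Integrable.of_finite (by fun_prop)

/-- The log-likelihood ratio of the history is integrable, and its mean is given by the number of times
that each action is chosen. -/
theorem integral_sum_logLikelihoodRatio (alg : BanditAlgorithm A.k) (θ θ' : Fin (d + 1) → ℝ)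
    (t : ℕ) :
    Integrable (fun h => ∑ s, A.logLikelihoodRatio θ θ' (h s)) (alg.historyLaw θ t) ∧
      ∫ h, ∑ s, A.logLikelihoodRatio θ θ' (h s) ∂(alg.historyLaw θ t) =
        -∫ h, ∑ s, (A.meanEvaluation θ' (h s).1 - A.meanEvaluation θ (h s).1) ^ 2 / 2
          ∂(alg.historyLaw θ t) := by
  let g : Fin A.k → ℝ := fun i => (A.meanEvaluation θ' i - A.meanEvaluation θ i) ^ 2 / 2
  have hg := alg.integrable_sum_action θ t g
  have hgm : Measurable fun p : Fin A.k × ℝ => g p.1 :=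
    (measurable_of_countable g).comp measurable_fst
  have hi : ∀ i, Integrable (fun y => y - A.meanEvaluation θ i) (A.evaluation θ i) := fun i =>
    (A.integrable_id_evaluation θ i).sub (integrable_const _)
  -- Adding half the squared shift of the means leaves a multiple of the noise, which is centred
  -- given the action.
  have key := alg.integral_sum_eq_zero_of_centered θ t
    (f := fun p => A.logLikelihoodRatio θ θ' p + g p.1)
    ((A.measurable_logLikelihoodRatio θ θ').add hgm)
    (fun i => by
      simpa [ActionSet.logLikelihoodRatio, g] using
        (hi i).mul_const (A.meanEvaluation θ' i - A.meanEvaluation θ i))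
    (fun i => by
      simp only [ActionSet.logLikelihoodRatio, g, sub_add_cancel]
      rw [integral_mul_const, integral_sub (A.integrable_id_evaluation θ i) (integrable_const _),
        A.integral_id_evaluation]
      simp)
  have heq : (fun h : Fin t → Fin A.k × ℝ => ∑ s, A.logLikelihoodRatio θ θ' (h s)) =
      fun h => ∑ s, (A.logLikelihoodRatio θ θ' (h s) + g (h s).1) - ∑ s, g (h s).1 := by
    funext h
    rw [Finset.sum_add_distrib, add_sub_cancel_right]
  rw [heq]
  refine ⟨key.1.sub hg, ?_⟩
  rw [integral_sub key.1 hg, key.2, zero_sub]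

/-- Change of measure between two parameters of the bandit problem. -/
theorem exp_neg_integral_le (alg : BanditAlgorithm A.k) (θ θ' : Fin (d + 1) → ℝ) (t : ℕ)
    {B : Set (Fin t → Fin A.k × ℝ)} (hB : MeasurableSet B) :
    Real.exp (-∫ h, ∑ s, (A.meanEvaluation θ' (h s).1 - A.meanEvaluation θ (h s).1) ^ 2 / 2
        ∂(alg.historyLaw θ t)) / 2 ≤
      (alg.historyLaw θ t).real Bᶜ + (alg.historyLaw θ' t).real B := by
  have hℓ := A.measurable_logLikelihoodRatio θ θ'
  have h := alg.integral_sum_logLikelihoodRatio θ θ' t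
  rw [← h.2]
  exact exp_integral_le_measureReal_compl_add (by fun_prop) h.1
    (alg.historyLaw_eq_withDensity θ θ' t) hB

/-- Taken with the indicator of the costly actions, this bounds their expected number of plays by
the regret. -/
theorem sum_gap_integral_le_regret (alg : BanditAlgorithm A.k) (θ : Fin (d + 1) → ℝ) (T : ℕ)
    {g : Fin A.k → ℝ} (hg : ∀ i, g i ≤ A.gap θ i) :
    ∫ h, ∑ s, g (h s).1 ∂(alg.historyLaw θ T) ≤ alg.regret θ T :=
  integral_mono (alg.integrable_sum_action θ T g) (alg.integrable_sum_action θ T _) fun _ =>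
    Finset.sum_le_sum fun _ _ => hg _

/-- A Markov-type bound, turning a probable costly event into regret. -/
theorem mul_measureReal_le_regret (alg : BanditAlgorithm A.k) (θ : Fin (d + 1) → ℝ) (T : ℕ)
    {B : Set (Fin T → Fin A.k × ℝ)} (hB : MeasurableSet B) {c : ℝ}
    (hgap : ∀ i, 0 ≤ A.gap θ i) (hc : ∀ h ∈ B, c ≤ ∑ s, A.gap θ (h s).1) :
    c * (alg.historyLaw θ T).real B ≤ alg.regret θ T := by
  have h1 : c * (alg.historyLaw θ T).real B =
      ∫ h, B.indicator (fun _ => c) h ∂(alg.historyLaw θ T) := by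
    rw [integral_indicator hB, setIntegral_const, smul_eq_mul, mul_comm]
  rw [h1]
  refine integral_mono ((integrable_const c).indicator hB) (alg.integrable_sum_action θ T _)
    fun h => ?_
  by_cases hh : h ∈ B
  · simpa [hh] using hc h hh
  · simpa [hh] using Finset.sum_nonneg fun s _ => hgap (h s).1

end BanditAlgorithm

/-! ### Generalized inverses and optimal designs for the bias. -/

/-- Every square real matrix has a generalized inverse. -/
theorem exists_isGeneralizedInverse {n : ℕ} (M : Matrix (Fin n) (Fin n) ℝ) :
    ∃ G, IsGeneralizedInverse M G := by
  let f := Matrix.toLin' M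
  -- A linear section of the map onto its range, extended to the whole space, is a generalized
  -- inverse.
  obtain ⟨g, hg⟩ := f.rangeRestrict.exists_rightInverse_of_surjective
    (LinearMap.range_eq_top.mpr f.surjective_rangeRestrict)
  obtain ⟨g', hg'⟩ := LinearMap.exists_extend g
  refine ⟨LinearMap.toMatrix' g', Matrix.toLin'.injective ?_⟩
  refine LinearMap.ext fun v => ?_
  have h1 : g' (f v) = g (f.rangeRestrict v) := by rw [← hg']; rfl
  have h2 : f (g (f.rangeRestrict v)) = f v :=
    congrArg Subtype.val (LinearMap.congr_fun hg (f.rangeRestrict v))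
  rw [Matrix.toLin'_mul, Matrix.toLin'_mul, Matrix.toLin'_toMatrix']
  change f (g' (f v)) = f v
  rw [h1, h2]

namespace ActionSet

variable {d : ℕ}

theorem V_transpose (A : ActionSet d) (π : Fin A.k → ℝ) : (A.V π)ᵀ = A.V π := by
  simp [V, transpose_sum, transpose_smul, transpose_vecMulVec]

theorem V_mulVec (A : ActionSet d) (π : Fin A.k → ℝ) (w : Fin (d + 1) → ℝ) :
    A.V π *ᵥ w = ∑ i, (π i * (A.a i ⬝ᵥ w)) • A.a i := by
  simp [V, sum_mulVec, smul_mulVec, vecMulVec_mulVec, smul_smul]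

theorem dotProduct_eLast (w : Fin (d + 1) → ℝ) : w ⬝ᵥ eLast d = w (Fin.last d) := by
  simp [eLast]

/-- The quadratic form of a generalized inverse, through a preimage of the vector. -/
theorem quadForm_eq_of_mulVec_eq (A : ActionSet d) {π : Fin A.k → ℝ}
    {G : Matrix (Fin (d + 1)) (Fin (d + 1)) ℝ} (hG : IsGeneralizedInverse (A.V π) G)
    {w : Fin (d + 1) → ℝ} (hw : A.V π *ᵥ w = eLast d) :
    eLast d ⬝ᵥ G *ᵥ eLast d = w (Fin.last d) := by
  have h1 : A.V π *ᵥ w = w ᵥ* A.V π := by rw [← vecMul_transpose, V_transpose]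
  rw [← dotProduct_eLast w, ← hw]
  conv_lhs => rw [h1, ← dotProduct_mulVec, ← h1, mulVec_mulVec, mulVec_mulVec, hG]

/-- Pairing `u` with `V(π) w = e_{d+1}` represents the bias of `u` as a `π`-weighted inner product
of evaluation means. With `u = w` it is the variance itself. -/
theorem last_eq_sum (A : ActionSet d) {π : Fin A.k → ℝ} {w : Fin (d + 1) → ℝ}
    (hw : A.V π *ᵥ w = eLast d) (u : Fin (d + 1) → ℝ) :
    u (Fin.last d) = ∑ i, π i * (A.a i ⬝ᵥ w) * (A.a i ⬝ᵥ u) := by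
  rw [← dotProduct_eLast u, ← hw, V_mulVec, dotProduct_sum]
  simp [dotProduct_comm u]

/-- A parameter under which all evaluations have means at most one in absolute value bounds the
variances of the bias estimators from below. -/
theorem sq_last_le_of_mem_biasVariances (A : ActionSet d) {u : Fin (d + 1) → ℝ}
    (hu : ∀ i, |A.a i ⬝ᵥ u| ≤ 1) {v : ℝ} (hv : v ∈ A.biasVariances) : u (Fin.last d) ^ 2 ≤ v := by
  obtain ⟨π, ⟨⟨hπ0, hπ1⟩, w, hw⟩, G, hG, rfl⟩ := hv
  rw [A.quadForm_eq_of_mulVec_eq hG hw, A.last_eq_sum hw w, A.last_eq_sum hw u]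
  -- Cauchy–Schwarz for the weights `π`; the factor depending on `u` is at most the total mass `1`.
  calc (∑ i, π i * (A.a i ⬝ᵥ w) * (A.a i ⬝ᵥ u)) ^ 2
      ≤ (∑ i, π i * (A.a i ⬝ᵥ w) * (A.a i ⬝ᵥ w)) * ∑ i, π i * (A.a i ⬝ᵥ u) ^ 2 := by
        refine Finset.sum_sq_le_sum_mul_sum_of_sq_le_mul _ (fun i _ => ?_) (fun i _ => ?_)
          (fun i _ => ?_)
        · rw [mul_assoc]; exact mul_nonneg (hπ0 i) (mul_self_nonneg _)
        · exact mul_nonneg (hπ0 i) (sq_nonneg _)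
        · exact le_of_eq (by ring)
    _ ≤ (∑ i, π i * (A.a i ⬝ᵥ w) * (A.a i ⬝ᵥ w)) * 1 := by
        refine mul_le_mul_of_nonneg_left ?_ (Finset.sum_nonneg fun i _ => ?_)
        · rw [← hπ1]
          refine Finset.sum_le_sum fun i _ => mul_le_of_le_one_right (hπ0 i) ?_
          rw [← sq_abs]
          exact pow_le_one₀ (abs_nonneg _) (hu i)
        · rw [mul_assoc]; exact mul_nonneg (hπ0 i) (mul_self_nonneg _)
    _ = _ := mul_one _

/-- Elfving's criterion: a design supported by actions whose evaluations have mean one under `u`, and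
for which `u` is proportional to a preimage of `e_{d+1}`, is optimal. -/
theorem isLeast_biasVariances (A : ActionSet d) {u : Fin (d + 1) → ℝ}
    (hu : ∀ i, |A.a i ⬝ᵥ u| ≤ 1) {π : Fin A.k → ℝ} (hπ : π ∈ stdSimplex ℝ (Fin A.k))
    (hw : A.V π *ᵥ (u (Fin.last d) • u) = eLast d) :
    IsLeast A.biasVariances (u (Fin.last d) ^ 2) := by
  obtain ⟨G, hG⟩ := exists_isGeneralizedInverse (A.V π)
  refine ⟨⟨π, ⟨hπ, _, hw⟩, G, hG, ?_⟩, fun v hv => A.sq_last_le_of_mem_biasVariances hu hv⟩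
  rw [A.quadForm_eq_of_mulVec_eq hG hw]
  simp [sq]

theorem a_dotProduct (A : ActionSet d) (i : Fin A.k) (θ : Fin (d + 1) → ℝ) :
    A.a i ⬝ᵥ θ =
      A.x i ⬝ᵥ (Fin.init θ : Fin d → ℝ) + ((A.z i : ℤ) : ℝ) * θ (Fin.last d) := by
  simp [a, dotProduct, Fin.sum_univ_castSucc, Fin.init]

theorem sub_le_gap (A : ActionSet d) (θ : Fin (d + 1) → ℝ) (i j : Fin A.k) :
    A.x j ⬝ᵥ (Fin.init θ : Fin d → ℝ) - A.x i ⬝ᵥ (Fin.init θ : Fin d → ℝ) ≤ A.gap θ i := by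
  rw [← sub_dotProduct]
  exact le_ciSup (f := fun j => (A.x j - A.x i) ⬝ᵥ (Fin.init θ : Fin d → ℝ))
    (Set.finite_range _).bddAbove j

theorem gap_nonneg (A : ActionSet d) (θ : Fin (d + 1) → ℝ) (i : Fin A.k) : 0 ≤ A.gap θ i := by
  simpa using A.sub_le_gap θ i i

/-! ### The hard action set. -/

/-- The covariates of `correlated`: the first two vectors of the canonical basis, the vector
`b = (-ρ, ρ - 1, 0, …, 0)`, and the sums of `b` and the other vectors of the canonical basis. -/
def correlatedCovariate (n : ℕ) (ρ : ℝ) : Fin (n + 3) → Fin (n + 2) → ℝ :=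
  Fin.cons (vecCons 1 (vecCons 0 0)) <| Fin.cons (vecCons 0 (vecCons 1 0)) <|
    Fin.cons (vecCons (-ρ) (vecCons (ρ - 1) 0)) fun j =>
      vecCons (-ρ) (vecCons (ρ - 1) (Pi.single j 1))

/-- The groups of `correlated`: only the second action is in the negative group. -/
def correlatedGroup (n : ℕ) : Fin (n + 3) → ℤˣ :=
  Fin.cons 1 <| Fin.cons (-1) fun _ => 1

theorem fin_eq_zero_or_one_or_two_or_succ {n : ℕ} (i : Fin (n + 3)) :
    i = 0 ∨ i = 1 ∨ i = 2 ∨ ∃ j : Fin n, i = j.succ.succ.succ := by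
  induction i using Fin.cases with
  | zero => exact Or.inl rfl
  | succ i =>
    induction i using Fin.cases with
    | zero => exact Or.inr (Or.inl rfl)
    | succ i =>
      induction i using Fin.cases with
      | zero => exact Or.inr (Or.inr (Or.inl rfl))
      | succ i => exact Or.inr (Or.inr (Or.inr ⟨i, rfl⟩))

section correlatedCovariate

variable (n : ℕ) (ρ : ℝ)

@[simp] theorem correlatedCovariate_zero :
    correlatedCovariate n ρ 0 = vecCons 1 (vecCons 0 0) := rfl

@[simp] theorem correlatedCovariate_one :
    correlatedCovariate n ρ 1 = vecCons 0 (vecCons 1 0) := rfl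

@[simp] theorem correlatedCovariate_two :
    correlatedCovariate n ρ 2 = vecCons (-ρ) (vecCons (ρ - 1) 0) := rfl

@[simp] theorem correlatedCovariate_succ (j : Fin n) :
    correlatedCovariate n ρ j.succ.succ.succ =
      vecCons (-ρ) (vecCons (ρ - 1) (Pi.single j 1)) := rfl

@[simp] theorem correlatedGroup_zero : correlatedGroup n 0 = 1 := rfl

@[simp] theorem correlatedGroup_one : correlatedGroup n 1 = -1 := rfl

@[simp] theorem correlatedGroup_two : correlatedGroup n 2 = 1 := rfl

@[simp] theorem correlatedGroup_succ (j : Fin n) : correlatedGroup n j.succ.succ.succ = 1 := rfl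

end correlatedCovariate

/-- The parameter with the given first two and last coordinates, the other ones being zero. -/
def sparseParameter (n : ℕ) (α β ω : ℝ) : Fin (n + 2 + 1) → ℝ :=
  Fin.snoc (vecCons α (vecCons β 0)) ω

/-- An action set in which the estimation of the bias requires bad actions; it is `ρ⁻²`-correlated. -/
def correlated (n : ℕ) {ρ : ℝ} (hρ : 0 < ρ) : ActionSet (n + 2) where
  k := n + 3
  x := correlatedCovariate n ρ
  z := correlatedGroup n
  x_injective := by
    have hρ'' : -ρ ≠ 1 := by linarith
    intro i j h
    have h0 := congrFun h 0
    have h1 := congrFun h 1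
    have h2 := fun l : Fin n => congrFun h l.succ.succ
    rcases fin_eq_zero_or_one_or_two_or_succ i with rfl | rfl | rfl | ⟨i, rfl⟩ <;>
    rcases fin_eq_zero_or_one_or_two_or_succ j with rfl | rfl | rfl | ⟨j, rfl⟩ <;>
    simp [hρ'', hρ''.symm] at h0 h1 h2 ⊢
    any_goals linarith
    · simpa using h2 j
    · simpa using h2 i
    · simpa [Pi.single_apply] using h2 i
  exists_group_pos := ⟨0, rfl⟩
  exists_group_neg := ⟨1, rfl⟩
  span_eq_top := by
    by_contra hne
    obtain ⟨f, hf0, hf⟩ := Submodule.exists_le_ker_of_lt_top _ (lt_top_iff_ne_top.mpr hne)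
    obtain ⟨w, rfl⟩ := (dotProductEquiv ℝ (Fin (n + 2 + 1))).surjective f
    refine hf0 ?_
    have h : ∀ i, correlatedCovariate n ρ i ⬝ᵥ (Fin.init w : Fin (n + 2) → ℝ) +
        ((correlatedGroup n i : ℤ) : ℝ) * w (Fin.last _) = 0 := by
      intro i
      have h1 := hf (Submodule.subset_span (Set.mem_range_self i))
      rw [LinearMap.mem_ker] at h1
      simpa [dotProductEquiv, dotProduct, Fin.sum_univ_castSucc, Fin.init, mul_comm] using h1
    suffices hw : w = 0 by rw [hw, map_zero]
    obtain ⟨w, ω, rfl⟩ : ∃ v ω, w = Fin.snoc v ω := ⟨_, _, (Fin.snoc_init_self w).symm⟩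
    have h0 := h 0
    have h1 := h 1
    have h2 := h 2
    have h3 := fun l : Fin n => h l.succ.succ.succ
    simp [vecHead, vecTail] at h0 h1 h2 h3
    have hω : ω = 0 := by
      -- In terms of the action vectors, `a₂ + ρ a₀ + (1 - ρ) a₁ = 2ρ e_{d+1}`.
      have : 2 * ρ * ω = 0 := by linear_combination h2 + ρ * h0 + (1 - ρ) * h1
      simpa [hρ.ne'] using this
    subst hω
    have hw0 : w 0 = 0 := by linarith
    have hw1 : w 1 = 0 := by linarith
    funext i
    induction i using Fin.lastCases with
    | last => simp
    | cast i =>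
      rw [Fin.snoc_castSucc, Pi.zero_apply]
      induction i using Fin.cases with
      | zero => exact hw0
      | succ i =>
        induction i using Fin.cases with
        | zero => exact hw1
        | succ i => simpa [hw0, hw1] using h3 i

theorem correlatedCovariate_dotProduct (n : ℕ) (ρ α β ω : ℝ) (i : Fin (n + 3)) :
    correlatedCovariate n ρ i ⬝ᵥ (Fin.init (sparseParameter n α β ω) : Fin (n + 2) → ℝ) =
      if i = 0 then α else if i = 1 then β else -(ρ * α) + (ρ - 1) * β := by
  rw [sparseParameter, Fin.init_snoc]
  rcases fin_eq_zero_or_one_or_two_or_succ i with rfl | rfl | rfl | ⟨i, rfl⟩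
  · simp
  · simp
  · have h1 : (2 : Fin (n + 3)) ≠ 0 := Fin.succ_ne_zero (1 : Fin (n + 2))
    have h2 : (2 : Fin (n + 3)) ≠ 1 := fun h =>
      Fin.succ_ne_zero (0 : Fin (n + 1)) (Fin.succ_injective (n + 2) h)
    simp [h1, h2]
  · have h1 : i.succ.succ.succ ≠ 0 := Fin.succ_ne_zero _
    have h2 : i.succ.succ.succ ≠ 1 := fun h => Fin.succ_ne_zero _ (Fin.succ_injective _ h)
    simp [h1, h2]

theorem correlatedGroup_apply (n : ℕ) (i : Fin (n + 3)) :
    ((correlatedGroup n i : ℤ) : ℝ) = if i = 1 then -1 else 1 := by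
  rcases fin_eq_zero_or_one_or_two_or_succ i with rfl | rfl | rfl | ⟨i, rfl⟩
  · simp
  · simp
  · have h2 : (2 : Fin (n + 3)) ≠ 1 := fun h =>
      Fin.succ_ne_zero (0 : Fin (n + 1)) (Fin.succ_injective (n + 2) h)
    simp [h2]
  · have h2 : i.succ.succ.succ ≠ 1 := fun h => Fin.succ_ne_zero _ (Fin.succ_injective _ h)
    simp [h2]

theorem correlated_mean (n : ℕ) {ρ : ℝ} (hρ : 0 < ρ) (α β ω : ℝ) (i : Fin (n + 3)) :
    (correlated n hρ).meanEvaluation (sparseParameter n α β ω) i =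
      if i = 0 then α + ω else if i = 1 then β - ω else -(ρ * α) + (ρ - 1) * β + ω := by
  have h1 := correlatedCovariate_dotProduct n ρ α β ω i
  have h2 := correlatedGroup_apply n i
  have h3 : sparseParameter n α β ω (Fin.last _) = ω := Fin.snoc_last _ _
  change correlatedCovariate n ρ i ⬝ᵥ _ + ((correlatedGroup n i : ℤ) : ℝ) * _ = _
  rw [h1, h2, h3]
  by_cases hi : i = 0
  · subst hi
    simp
  · by_cases hi' : i = 1 <;> (simp [hi, hi']; try ring)

/-- Elfving's criterion applies because some `u` gives every action mean one: then `V(π) u = ∑ π i •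
a i`, and it remains to balance the weights so that this sum is `ρ e_{d+1}`. -/
theorem correlated_isLeast (n : ℕ) {ρ : ℝ} (hρ : 0 < ρ) (hρ1 : ρ ≤ 1) :
    IsLeast (correlated n hρ).biasVariances (ρ⁻¹ ^ 2) := by
  -- The solution of the linear system `a_i ⬝ᵥ u = 1`; its last coordinate `ρ⁻¹` gives the variance.
  let u := sparseParameter n (1 - ρ⁻¹) (1 + ρ⁻¹) ρ⁻¹
  have hρi : ρ * ρ⁻¹ = 1 := mul_inv_cancel₀ hρ.ne'
  have hlast : u (Fin.last _) = ρ⁻¹ := Fin.snoc_last _ _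
  have hau : ∀ i, (correlated n hρ).a i ⬝ᵥ u = 1 := by
    intro i
    rw [a_dotProduct]
    refine (correlated_mean n hρ _ _ _ i).trans ?_
    split_ifs
    · ring
    · ring
    · linear_combination 2 * hρi
  -- The weights cancel all covariates: `ρ/2 • e₁ + (1 - ρ)/2 • e₂ + 1/2 • b = 0`, while the groups
  -- sum to `ρ`.
  let π : Fin (n + 3) → ℝ := Fin.cons (ρ / 2) <| Fin.cons ((1 - ρ) / 2) <| Fin.cons (1 / 2) 0
  have hπ : π ∈ stdSimplex ℝ (Fin (n + 3)) := by
    constructor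
    · intro i
      rcases fin_eq_zero_or_one_or_two_or_succ i with rfl | rfl | rfl | ⟨i, rfl⟩
      · change 0 ≤ ρ / 2
        positivity
      · change 0 ≤ (1 - ρ) / 2
        linarith
      · change (0 : ℝ) ≤ 1 / 2
        norm_num
      · exact le_rfl
    · simp [π, Fin.sum_univ_succ]
      ring
  rw [← hlast]
  refine isLeast_biasVariances (π := fun i : Fin (correlated n hρ).k => π i) _
    (fun i => by simp [hau]) hπ ?_
  rw [V_mulVec]
  simp only [dotProduct_smul, hau, hlast, smul_eq_mul, mul_one]
  change ∑ i : Fin (n + 3), (π i * ρ⁻¹) •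
    (Fin.snoc (correlatedCovariate n ρ i) ((correlatedGroup n i : ℤ) : ℝ) : Fin (n + 3) → ℝ) = _
  have hsum : ∀ g : Fin (n + 3) → Fin (n + 3) → ℝ, ∑ i, (π i * ρ⁻¹) • g i =
      (ρ / 2 * ρ⁻¹) • g 0 + ((1 - ρ) / 2 * ρ⁻¹) • g 1 + (1 / 2 * ρ⁻¹) • g 2 := by
    intro g
    simp [π, Fin.sum_univ_succ, add_assoc]
  rw [hsum]
  funext i
  induction i using Fin.lastCases with
  | last =>
    simp only [eLast, Pi.add_apply, Pi.smul_apply, Fin.snoc_last, Pi.single_eq_same, smul_eq_mul,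
      correlatedGroup_zero, correlatedGroup_one, correlatedGroup_two]
    push_cast
    linear_combination hρi
  | cast i =>
    have hi : Fin.castSucc i ≠ Fin.last (n + 2) := (Fin.castSucc_lt_last i).ne
    simp only [eLast, Pi.add_apply, Pi.smul_apply, Fin.snoc_castSucc, Pi.single_apply, hi,
      if_false, smul_eq_mul]
    induction i using Fin.cases with
    | zero => simp; ring
    | succ i =>
      induction i using Fin.cases with
      | zero => simp; ring
      | succ i => simp

/-- From the third action on, the reward is minus a convex combination of `α` and `β`. -/
theorem correlated_admissible (n : ℕ) {ρ : ℝ} (hρ : 0 < ρ) (hρ1 : ρ ≤ 1) {α β : ℝ} (ω : ℝ)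
    (hα : |α| ≤ 1) (hβ : |β| ≤ 1) : (correlated n hρ).Admissible (sparseParameter n α β ω) := by
  intro i
  have h := correlatedCovariate_dotProduct n ρ α β ω i
  change |correlatedCovariate n ρ i ⬝ᵥ _| ≤ 1
  rw [h]
  split_ifs
  · exact hα
  · exact hβ
  · rw [abs_le] at *
    constructor <;> nlinarith

theorem correlated_sub_le_gap (n : ℕ) {ρ : ℝ} (hρ : 0 < ρ) (α β ω : ℝ) (i : Fin (n + 3)) :
    max α β - (if i = 0 then α else if i = 1 then β else -(ρ * α) + (ρ - 1) * β) ≤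
      (correlated n hρ).gap (sparseParameter n α β ω) i := by
  have h : ∀ j : Fin (n + 3),
      correlatedCovariate n ρ j ⬝ᵥ (Fin.init (sparseParameter n α β ω) : Fin (n + 2) → ℝ) -
        correlatedCovariate n ρ i ⬝ᵥ (Fin.init (sparseParameter n α β ω) : Fin (n + 2) → ℝ) ≤
      (correlated n hρ).gap (sparseParameter n α β ω) i :=
    (correlated n hρ).sub_le_gap (sparseParameter n α β ω) i
  have h0 := h 0
  have h1 := h 1
  rw [correlatedCovariate_dotProduct n ρ α β ω i, correlatedCovariate_dotProduct] at h0 h1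
  rw [if_pos rfl] at h0
  rw [if_neg (by simp), if_pos rfl] at h1
  rcases max_choice α β with h | h <;> rw [h] <;> assumption

end ActionSet

/-! ### The two-point argument and the final tuning. -/

open ActionSet

/-- On `ActionSet.correlated`, every algorithm either wastes rounds on the informative actions or
confuses the first two actions. -/
theorem BanditAlgorithm.exists_le_regret_correlated (n : ℕ) {ρ : ℝ} (hρ : 0 < ρ) (hρ1 : ρ ≤ 1)
    (T : ℕ) {Δ : ℝ} (hΔ0 : 0 ≤ Δ) (hΔ1 : Δ ≤ 1) (hT : ρ ^ 2 * Δ ^ 3 * T ≤ 1)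
    (alg : BanditAlgorithm (correlated n hρ).k) :
    ∃ θ, (correlated n hρ).Admissible θ ∧ Δ * T / (8 * Real.exp 1) ≤ alg.regret θ T := by
  -- The biases compensate the exchange of the two rewards, so that the first two actions have the
  -- same evaluation laws under `θ` and `θ'`.
  let θ := sparseParameter n 1 (1 - Δ) (-(Δ / 2))
  let θ' := sparseParameter n (1 - Δ) 1 (Δ / 2)
  have habs : |1 - Δ| ≤ 1 := by rw [abs_le]; constructor <;> linarith
  by_contra! hcon
  have h1 := hcon θ (correlated_admissible n hρ hρ1 _ (by simp) habs)
  have h2 := hcon θ' (correlated_admissible n hρ hρ1 _ habs (by simp))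
  let first : Fin (n + 3) → ℝ := fun i => if i = 0 then 1 else 0
  let bad : Fin (n + 3) → ℝ := fun i => if i = 0 then 0 else if i = 1 then 0 else 1
  have hgap : ∀ i, bad i ≤ (correlated n hρ).gap θ i := by
    intro i
    refine le_trans ?_ (correlated_sub_le_gap n hρ _ _ _ i)
    rw [max_eq_left (by linarith)]
    simp only [bad]
    split_ifs <;> nlinarith
  have hgap' : ∀ i, Δ * (1 - first i) ≤ (correlated n hρ).gap θ i := by
    intro i
    refine le_trans ?_ (correlated_sub_le_gap n hρ _ _ _ i)
    rw [max_eq_left (by linarith)]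
    simp only [first]
    split_ifs <;> nlinarith
  have hgap'' : ∀ i, Δ * first i ≤ (correlated n hρ).gap θ' i := by
    intro i
    refine le_trans ?_ (correlated_sub_le_gap n hρ _ _ _ i)
    rw [max_eq_right (by linarith)]
    simp only [first]
    split_ifs <;> nlinarith
  have hmean : ∀ i, ((correlated n hρ).meanEvaluation θ' i - (correlated n hρ).meanEvaluation θ i) ^ 2 / 2 =
      2 * ρ ^ 2 * Δ ^ 2 * bad i := by
    intro i
    have e1 : (correlated n hρ).meanEvaluation θ i = _ := correlated_mean n hρ _ _ _ i
    have e2 : (correlated n hρ).meanEvaluation θ' i = _ := correlated_mean n hρ _ _ _ i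
    rw [e1, e2]
    simp only [bad]
    split_ifs <;> ring
  have hN := alg.sum_gap_integral_le_regret θ T hgap
  -- Playing the first action at least half of the time costs `ΔT/2` under `θ'`; playing it less
  -- often costs as much under `θ`.
  let B : Set (Fin T → Fin (correlated n hρ).k × ℝ) := {h | (T : ℝ) / 2 ≤ ∑ s, first (h s).1}
  have hfm : Measurable fun p : Fin (correlated n hρ).k × ℝ => first p.1 :=
    (measurable_of_countable first).comp measurable_fst
  have hB : MeasurableSet B := measurableSet_le measurable_const
    (Finset.measurable_sum _ fun s _ => hfm.comp (measurable_pi_apply s))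
  have hBH := alg.exp_neg_integral_le θ θ' T hB
  simp only [hmean] at hBH
  simp only [← Finset.mul_sum] at hBH
  rw [integral_const_mul] at hBH
  have hR := alg.mul_measureReal_le_regret θ T hB.compl (c := Δ * (T / 2)) ((correlated n hρ).gap_nonneg θ)
    (fun h hh => by
      have hh' : ∑ s, first (h s).1 < (T : ℝ) / 2 := by simpa [B] using hh
      calc Δ * (T / 2) ≤ Δ * (T - ∑ s, first (h s).1) := by gcongr; linarith
        _ = ∑ s, Δ * (1 - first (h s).1) := by simp [← Finset.mul_sum]
        _ ≤ _ := Finset.sum_le_sum fun s _ => hgap' _)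
  have hR' := alg.mul_measureReal_le_regret θ' T hB (c := Δ * (T / 2)) ((correlated n hρ).gap_nonneg θ')
    (fun h hh => by
      calc Δ * (T / 2) ≤ Δ * ∑ s, first (h s).1 := by gcongr; exact hh
        _ = ∑ s, Δ * first (h s).1 := by rw [Finset.mul_sum]
        _ ≤ _ := Finset.sum_le_sum fun s _ => hgap'' _)
  set N := ∫ h, ∑ s, bad (h s).1 ∂(alg.historyLaw θ T)
  have hX : 0 ≤ Δ * T := by positivity
  have he : 1 ≤ Real.exp 1 := Real.one_le_exp zero_le_one
  -- The assumed small regret under `θ` is used a first time, crudely, just to bring the divergence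
  -- below `1`; it returns at the end together with the regret under `θ'`.
  have hNle : N ≤ Δ * T / 2 := by
    have : Δ * T / (8 * Real.exp 1) ≤ Δ * T / 2 := by gcongr; linarith
    linarith
  have hKL : 2 * ρ ^ 2 * Δ ^ 2 * N ≤ 1 := by
    calc 2 * ρ ^ 2 * Δ ^ 2 * N ≤ 2 * ρ ^ 2 * Δ ^ 2 * (Δ * T / 2) := by gcongr
      _ = ρ ^ 2 * Δ ^ 3 * T := by ring
      _ ≤ 1 := hT
  have hexp : Real.exp (-1) ≤ Real.exp (-(2 * ρ ^ 2 * Δ ^ 2 * N)) := by gcongr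
  have hfin : Δ * (T / 2) * (Real.exp (-1) / 2) ≤
      Δ * (T / 2) * ((alg.historyLaw θ T).real Bᶜ + (alg.historyLaw θ' T).real B) := by
    refine mul_le_mul_of_nonneg_left ?_ (by linarith)
    linarith
  -- The two regrets sum to at least `ΔT/(4e)`, so they cannot both be below half of it.
  have hdiv : Δ * T / (8 * Real.exp 1) = Δ * (T / 2) * (Real.exp (-1) / 2) / 2 := by
    rw [Real.exp_neg]
    field_simp
    ring
  linarith

theorem theorem3 (κ : ℝ) (hκ : 1 ≤ κ) (d : ℕ) (hd : 2 ≤ d) (T : ℕ) (hT : 4 ^ 3 * κ ≤ (T : ℝ)) :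
    ∃ A : ActionSet d, A.IsCorrelated κ ∧
      ∀ alg : BanditAlgorithm A.k, ∃ θ : Fin (d + 1) → ℝ, A.Admissible θ ∧
        κ ^ (1 / 3 : ℝ) * (T : ℝ) ^ (2 / 3 : ℝ) / (8 * Real.exp 1) ≤ alg.regret θ T := by
  obtain ⟨n, rfl⟩ : ∃ n, d = n + 2 := ⟨d - 2, by omega⟩
  have hκ0 : 0 < κ := by linarith
  have hT0 : (0 : ℝ) < T := by linarith
  -- With `ρ = κ^(-1/2)` the minimal variance `ρ⁻²` is exactly `κ`.
  have hρ : 0 < (√κ)⁻¹ := by positivity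
  have hρ1 : (√κ)⁻¹ ≤ 1 := inv_le_one_of_one_le₀ (Real.one_le_sqrt.mpr hκ)
  have hρ2 : (√κ)⁻¹ ^ 2 = κ⁻¹ := by rw [inv_pow, Real.sq_sqrt hκ0.le]
  -- This choice makes the divergence budget tight: `ρ² Δ³ T = 1`.
  let Δ : ℝ := (κ / T) ^ (1 / 3 : ℝ)
  have hΔ0 : 0 ≤ Δ := by positivity
  have hΔ1 : Δ ≤ 1 := Real.rpow_le_one (by positivity) (by rw [div_le_one hT0]; linarith) (by norm_num)
  have hΔ3 : Δ ^ 3 = κ / T := by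
    rw [← Real.rpow_natCast, ← Real.rpow_mul (by positivity)]
    norm_num
  have hΔT : κ ^ (1 / 3 : ℝ) * (T : ℝ) ^ (2 / 3 : ℝ) = Δ * T := by
    have h : (T : ℝ) ^ (2 / 3 : ℝ) = T / (T : ℝ) ^ (1 / 3 : ℝ) := by
      rw [eq_div_iff (by positivity), ← Real.rpow_add hT0]
      norm_num
    simp only [Δ]
    rw [h, Real.div_rpow hκ0.le hT0.le]
    ring
  refine ⟨correlated n hρ, ⟨_, correlated_isLeast n hρ hρ1, ?_⟩, fun alg => ?_⟩
  · rw [inv_inv, Real.sq_sqrt hκ0.le]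
  · rw [hΔT]
    refine alg.exists_le_regret_correlated n hρ hρ1 T hΔ0 hΔ1 (le_of_eq ?_)
    rw [hρ2, hΔ3]
    field_simp
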